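/- Let $n\ge 1$, $s\ge 2$, and let $M^{2n+s}(f,Q,\xi_i,\eta^i,g)$ be a metric weak $f$-manifold. That is, $M$ is a smooth (Hausdorff, second countable) manifold of dimension $2n+s$ with a smooth $(1,1)$-tensor $f$ of rank $2n$, a nonsingular smooth $(1,1)$-tensor $Q$, smooth vector fields $\xi_1,\dots,\xi_s$, smooth $1$-forms $\eta^1,\dots,\eta^s$ and a Riemannian metric $g$ such that $$f^3+fQ=0,\quad f^2=-Q+\sum_i\eta^i\otimes\xi_i,\quad \eta^i(\xi_j)=\delta^i_j,\quad Q\xi_i=\xi_i,$$ the distribution $\bigcap_i\ker\eta^i$ is $f$-invariant, and $g(fX,fY)=g(X,QY)-\sum_i\eta^i(X)\eta^i(Y)$ for all vector fields $X,Y$. Put $\widetilde Q=Q-\mathrm{id}$, $\bar\xi=\sum_i\xi_i$, $\bar\eta=\sum_i\eta^i$, $\Phi(X,Y)=g(X,fY)$, and use the normalizations $2\,d\eta(X,Y)=X(\eta(Y))-Y(\eta(X))-\eta([X,Y])$, $3\,d\Phi(X,Y,Z)=X\Phi(Y,Z)+Y\Phi(Z,X)+Z\Phi(X,Y)-\Phi([X,Y],Z)-\Phi([Z,X],Y)-\Phi([Y,Z],X)$,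 $3\,(\bar\eta\wedge\Phi)(X,Y,Z)=\bar\eta(X)\Phi(Y,Z)+\bar\eta(Y)\Phi(Z,X)+\bar\eta(Z)\Phi(X,Y)$. Define the tensors $$\mathcal N^{(1)}(X,Y)=f^2[X,Y]+[fX,fY]-f[fX,Y]-f[X,fY]+2\sum_i d\eta^i(X,Y)\,\xi_i,$$ $$\begin{aligned}\mathcal N^{(5)}(X,Y,Z)={}&X\big(g(fY,\widetilde QZ)\big)+fZ\big(g(X,\widetilde QY)\big)-fY\big(g(X,\widetilde QZ)\big)+g([X,fZ],\widetilde QY)-g([X,fY],\widetilde QZ)\\&+g\big([Y,fZ]-[Z,fY]-f[Y,Z],\,\widetilde QX\big).\end{aligned}$$ Let $\beta$ be a nonzero smooth function on $M$, and let $\nabla$ be the Levi-Civita connection of $g$. The manifold is called a weak $\beta$-Kenmotsu $f$-manifold if $\mathcal N^{(1)}=0$ and $(\nabla_Xf)Y=\beta\{g(fX,Y)\,\bar\xi-\bar\eta(Y)\,fX\}$ for all vector fields $X,Y$. **Theorem.** $M^{2n+s}(f,Q,\xi_i,\eta^i,g)$ is a weak $\beta$-Kenmotsu $f$-manifold if and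 only if, for all vector fields $X,Y,Z$ and all $i$, $$\mathcal N^{(1)}=0,\qquad d\eta^i=0,\qquad d\Phi=2\beta\,\bar\eta\wedge\Phi,\qquad \mathcal N^{(5)}(X,Y,Z)=2\beta\,\bar\eta(X)\,g(fY,\widetilde QZ).$$ -/

import Mathlib

open Bundle VectorField
open scoped Manifold ContDiff

noncomputable section

namespace WeakKenmotsu

section General

variable {E : Type*} [NormedAddCommGroup E] [NormedSpace ℝ E] [FiniteDimensional ℝ E]
  {H : Type*} [TopologicalSpace H] {I : ModelWithCorners ℝ E H}
  {M : Type*} [TopologicalSpace M] [ChartedSpace H M] [IsManifold I ∞ M]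

/-- Smooth vector fields on `M`. -/
def SmoothVectorField (X : Π x : M, TangentSpace I x) : Prop :=
  ContMDiff I (I.prod 𝓘(ℝ, E)) ∞ (fun x ↦ TotalSpace.mk' E x (X x))

/-- Smooth `(1,1)`-tensor fields on `M`. -/
def SmoothEndField (S : Π x : M, TangentSpace I x →L[ℝ] TangentSpace I x) : Prop :=
  ContMDiff I (I.prod 𝓘(ℝ, E →L[ℝ] E)) ∞ (fun x ↦ TotalSpace.mk' (E →L[ℝ] E) x (S x))

/-- Smooth `1`-forms on `M`. -/
def SmoothOneForm (α : Π x : M, TangentSpace I x →L[ℝ] ℝ) : Prop :=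
  ContMDiff I (I.prod 𝓘(ℝ, E →L[ℝ] ℝ)) ∞ (fun x ↦ TotalSpace.mk' (E →L[ℝ] ℝ) x (α x))

/-- The derivative `X(h)` of the function `h` along the vector field `X`. -/
def dirDeriv (X : Π x : M, TangentSpace I x) (h : M → ℝ) (x : M) : ℝ :=
  mvfderiv I h x (X x)

/-- The vector field `S X`, for a `(1,1)`-tensor field `S`. -/
def app (S : Π x : M, TangentSpace I x →L[ℝ] TangentSpace I x)
    (X : Π x : M, TangentSpace I x) : Π x : M, TangentSpace I x :=
  fun x ↦ S x (X x)

/-- The Nijenhuis torsion `[S,S](X,Y) = S²[X,Y] + [SX,SY] - S[SX,Y] - S[X,SY]`. -/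
def nijenhuis (S : Π x : M, TangentSpace I x →L[ℝ] TangentSpace I x)
    (X Y : Π x : M, TangentSpace I x) (x : M) : TangentSpace I x :=
  S x (S x (mlieBracket I X Y x)) + mlieBracket I (app S X) (app S Y) x
    - S x (mlieBracket I (app S X) Y x) - S x (mlieBracket I X (app S Y) x)

/-- The exterior derivative of a `1`-form, normalized by
`2 dα(X,Y) = X(α(Y)) - Y(α(X)) - α([X,Y])`. -/
def dOneForm (α : Π x : M, TangentSpace I x →L[ℝ] ℝ)
    (X Y : Π x : M, TangentSpace I x) (x : M) : ℝ :=
  (1 / 2 : ℝ) * (dirDeriv X (fun y ↦ α y (Y y)) x - dirDeriv Y (fun y ↦ α y (X y)) x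
    - α x (mlieBracket I X Y x))

/-- The exterior derivative of a `2`-form, normalized by
`3 dΦ(X,Y,Z) = XΦ(Y,Z) + YΦ(Z,X) + ZΦ(X,Y) - Φ([X,Y],Z) - Φ([Z,X],Y) - Φ([Y,Z],X)`. -/
def dTwoForm (Φ : Π x : M, TangentSpace I x → TangentSpace I x → ℝ)
    (X Y Z : Π x : M, TangentSpace I x) (x : M) : ℝ :=
  (1 / 3 : ℝ) * (dirDeriv X (fun y ↦ Φ y (Y y) (Z y)) x + dirDeriv Y (fun y ↦ Φ y (Z y) (X y)) x
    + dirDeriv Z (fun y ↦ Φ y (X y) (Y y)) x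
    - Φ x (mlieBracket I X Y x) (Z x) - Φ x (mlieBracket I Z X x) (Y x)
    - Φ x (mlieBracket I Y Z x) (X x))

/-- The wedge product of a `1`-form with a `2`-form at a point, normalized by
`3 (α ∧ Φ)(u,v,w) = α(u)Φ(v,w) + α(v)Φ(w,u) + α(w)Φ(u,v)`. -/
def wedgeOneTwo {x : M} (α : TangentSpace I x →L[ℝ] ℝ)
    (Φ : TangentSpace I x → TangentSpace I x → ℝ) (u v w : TangentSpace I x) : ℝ :=
  (1 / 3 : ℝ) * (α u * Φ v w + α v * Φ w u + α w * Φ u v)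

/-- `cov` is the Levi-Civita connection of `g`: it is torsion-free and
`X(g(Y,Z)) = g(∇_X Y, Z) + g(Y, ∇_X Z)`. As in Mathlib, `cov Y x (X x)` is `∇_X Y` at `x`. -/
def IsLeviCivita (g : ContMDiffRiemannianMetric I ∞ E (fun x : M ↦ TangentSpace I x))
    (cov : CovariantDerivative I E (fun x : M ↦ TangentSpace I x)) : Prop :=
  cov.torsion = 0 ∧
  ∀ X Y Z : Π x : M, TangentSpace I x,
    SmoothVectorField X → SmoothVectorField Y → SmoothVectorField Z →
    ∀ x, dirDeriv X (fun y ↦ g.inner y (Y y) (Z y)) x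
      = g.inner x (cov Y x (X x)) (Z x) + g.inner x (Y x) (cov Z x (X x))

end General

/-- A weak metric `f`-structure `(f, Q, ξ_i, η^i, g)` on the smooth manifold `M` of
dimension `2n + s`, with `f`-invariant contact distribution `⋂ ker η^i`. -/
structure WeakMetricFStructure (n s : ℕ) (M : Type*) [TopologicalSpace M]
    [ChartedSpace (EuclideanSpace ℝ (Fin (2 * n + s))) M] [IsManifold (𝓡 (2 * n + s)) ∞ M] where
  f : Π x : M, TangentSpace (𝓡 (2 * n + s)) x →L[ℝ] TangentSpace (𝓡 (2 * n + s)) x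
  Q : Π x : M, TangentSpace (𝓡 (2 * n + s)) x →L[ℝ] TangentSpace (𝓡 (2 * n + s)) x
  ξ : Fin s → Π x : M, TangentSpace (𝓡 (2 * n + s)) x
  η : Fin s → Π x : M, TangentSpace (𝓡 (2 * n + s)) x →L[ℝ] ℝ
  g : ContMDiffRiemannianMetric (𝓡 (2 * n + s)) ∞ (EuclideanSpace ℝ (Fin (2 * n + s)))
    (fun x : M ↦ TangentSpace (𝓡 (2 * n + s)) x)
  smooth_f : SmoothEndField f
  smooth_Q : SmoothEndField Q
  smooth_ξ : ∀ i, SmoothVectorField (ξ i)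
  smooth_η : ∀ i, SmoothOneForm (η i)
  rank_f : ∀ x, Module.finrank ℝ (LinearMap.range (f x).toLinearMap) = 2 * n
  nonsingular_Q : ∀ x, Function.Bijective (Q x)
  f_cube : ∀ x v, f x (f x (f x v)) + f x (Q x v) = 0
  f_sq : ∀ x v, f x (f x v) = -Q x v + ∑ i, η i x v • ξ i x
  η_ξ : ∀ x i j, η i x (ξ j x) = if i = j then 1 else 0
  Q_ξ : ∀ x i, Q x (ξ i x) = ξ i x
  contact_invariant : ∀ x v, (∀ i, η i x v = 0) → ∀ i, η i x (f x v) = 0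
  compatible : ∀ x u v,
    g.inner x (f x u) (f x v) = g.inner x u (Q x v) - ∑ i, η i x u * η i x v

namespace WeakMetricFStructure

variable {n s : ℕ} {M : Type*} [TopologicalSpace M]
  [ChartedSpace (EuclideanSpace ℝ (Fin (2 * n + s))) M] [IsManifold (𝓡 (2 * n + s)) ∞ M]
  (S : WeakMetricFStructure n s M)

/-- `Q̃ = Q - id`. -/
def Qtilde (x : M) : TangentSpace (𝓡 (2 * n + s)) x →L[ℝ] TangentSpace (𝓡 (2 * n + s)) x :=
  S.Q x - ContinuousLinearMap.id ℝ (TangentSpace (𝓡 (2 * n + s)) x)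

/-- `ξ̄ = ∑ ξ_i`. -/
def xiBar (x : M) : TangentSpace (𝓡 (2 * n + s)) x := ∑ i, S.ξ i x

/-- `η̄ = ∑ η^i`. -/
def etaBar (x : M) : TangentSpace (𝓡 (2 * n + s)) x →L[ℝ] ℝ := ∑ i, S.η i x

/-- The fundamental `2`-form `Φ(u,v) = g(u, f v)`. -/
def Phi (x : M) (u v : TangentSpace (𝓡 (2 * n + s)) x) : ℝ := S.g.inner x u (S.f x v)

/-- The normality tensor `N⁽¹⁾(X,Y) = [f,f](X,Y) + 2 ∑ dη^i(X,Y) ξ_i`. -/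
def N1 (X Y : Π x : M, TangentSpace (𝓡 (2 * n + s)) x) (x : M) :
    TangentSpace (𝓡 (2 * n + s)) x :=
  nijenhuis S.f X Y x + ∑ i, (2 * dOneForm (S.η i) X Y x) • S.ξ i x

/-- The tensor `N⁽⁵⁾(X,Y,Z) = X(g(fY,Q̃Z)) + fZ(g(X,Q̃Y)) - fY(g(X,Q̃Z)) + g([X,fZ],Q̃Y)
- g([X,fY],Q̃Z) + g([Y,fZ] - [Z,fY] - f[Y,Z], Q̃X)`. The first term is what makes the expression
`C^∞(M)`-linear in `Y` and `Z`. -/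
def N5 (X Y Z : Π x : M, TangentSpace (𝓡 (2 * n + s)) x) (x : M) : ℝ :=
  dirDeriv X (fun y ↦ S.g.inner y (S.f y (Y y)) (S.Qtilde y (Z y))) x
    + dirDeriv (app S.f Z) (fun y ↦ S.g.inner y (X y) (S.Qtilde y (Y y))) x
    - dirDeriv (app S.f Y) (fun y ↦ S.g.inner y (X y) (S.Qtilde y (Z y))) x
    + S.g.inner x (mlieBracket (𝓡 (2 * n + s)) X (app S.f Z) x) (S.Qtilde x (Y x))
    - S.g.inner x (mlieBracket (𝓡 (2 * n + s)) X (app S.f Y) x) (S.Qtilde x (Z x))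
    + S.g.inner x (mlieBracket (𝓡 (2 * n + s)) Y (app S.f Z) x
        - mlieBracket (𝓡 (2 * n + s)) Z (app S.f Y) x
        - S.f x (mlieBracket (𝓡 (2 * n + s)) Y Z x)) (S.Qtilde x (X x))

/-- The structure is normal: `N⁽¹⁾ = 0`. -/
def IsNormal : Prop :=
  ∀ X Y : Π x : M, TangentSpace (𝓡 (2 * n + s)) x,
    SmoothVectorField X → SmoothVectorField Y → ∀ x, S.N1 X Y x = 0

/-- The structure is a weak `β`-Kenmotsu `f`-structure: `β` is a nonzero smooth function, the
structure is normal, and the Levi-Civita connection satisfies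
`(∇_X f) Y = β {g(fX,Y) ξ̄ - η̄(Y) fX}`, where `(∇_X f) Y = ∇_X (fY) - f (∇_X Y)`. -/
def IsWeakBetaKenmotsu (β : M → ℝ) : Prop :=
  ContMDiff (𝓡 (2 * n + s)) 𝓘(ℝ) ∞ β ∧ β ≠ 0 ∧ S.IsNormal ∧
  ∃ cov : CovariantDerivative (𝓡 (2 * n + s)) (EuclideanSpace ℝ (Fin (2 * n + s)))
      (fun x : M ↦ TangentSpace (𝓡 (2 * n + s)) x),
    IsLeviCivita S.g cov ∧
    ∀ X Y : Π x : M, TangentSpace (𝓡 (2 * n + s)) x,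
      SmoothVectorField X → SmoothVectorField Y → ∀ x,
        cov (app S.f Y) x (X x) - S.f x (cov Y x (X x))
          = β x • (S.g.inner x (S.f x (X x)) (Y x) • S.xiBar x
              - S.etaBar x (Y x) • S.f x (X x))

end WeakMetricFStructure

end WeakKenmotsu

end

open WeakKenmotsu

/-!
A Koszul-type identity expresses `2 g((∇_X f)Y, Z)` through `dΦ`, `N⁽¹⁾`, `N⁽⁵⁾` and the `dη^i`.
If `N⁽¹⁾ = 0`, `dη^i = 0` and `dΦ = 2β η̄ ∧ Φ`, it reads: twice the defect of the Kenmotsu formula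
for `∇f` is the defect of the equation for `N⁽⁵⁾`, so each of these two conditions implies the
other. Moreover the Kenmotsu formula yields the equation for `dΦ`, by alternation, and `[f,f] = 0`;
then normality leaves `∑ dη^i(X,Y) ξ_i = 0`, that is, `dη^i = 0`.
-/

namespace WeakKenmotsu

section LeviCivita

variable {E : Type*} [NormedAddCommGroup E] [NormedSpace ℝ E]
  {H : Type*} [TopologicalSpace H] {I : ModelWithCorners ℝ E H}
  {M : Type*} [TopologicalSpace M] [ChartedSpace H M]
  {X X' Y Y' Z : Π x : M, TangentSpace I x} {x : M}

lemma dirDeriv_sum {ι : Type} (t : Finset ι) {φ : ι → M → ℝ} (hφ : ∀ i, MDiffAt (φ i) x) :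
    dirDeriv X (fun y ↦ ∑ i ∈ t, φ i y) x = ∑ i ∈ t, dirDeriv X (φ i) x := by
  have hsum := HasMFDerivAt.sum (t := t) fun i _ ↦ (hφ i).hasMFDerivAt
  rw [← Finset.sum_fn]
  simp only [dirDeriv, mvfderiv, hsum.mfderiv]
  exact _root_.sum_apply ..

variable [IsManifold I ∞ M]

lemma SmoothVectorField.mdiffAt (hX : SmoothVectorField X) (x : M) : MDiffAt (T% X) x :=
  (ContMDiff.contMDiffAt hX).mdifferentiableAt (by simp)

lemma SmoothEndField.app {S : Π x : M, TangentSpace I x →L[ℝ] TangentSpace I x}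
    (hS : SmoothEndField S) (hX : SmoothVectorField X) : SmoothVectorField (app S X) :=
  ContMDiff.clm_bundle_apply (b := fun x : M ↦ x) hS hX

lemma exists_smoothVectorField_apply_eq [FiniteDimensional ℝ E] [T2Space M]
    (x : M) (v : TangentSpace I x) :
    ∃ X : Π x : M, TangentSpace I x, SmoothVectorField X ∧ X x = v := by
  obtain ⟨t, ht, hsmooth⟩ := FiberBundle.exists_contMDiffOn_extend (k := ∞) I E v
  obtain ⟨u, hut, hu, hxu⟩ := mem_nhds_iff.mp ht
  obtain ⟨ψ, -, hψ⟩ := (SmoothBumpFunction.nhds_basis_tsupport (I := I) x).mem_iff.mp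
    (hu.mem_nhds hxu)
  refine ⟨(ψ : M → ℝ) • FiberBundle.extend E v, ?_, by simp⟩
  exact ContMDiffOn.smul_section_of_tsupport ψ.contMDiff.contMDiffOn hu hψ (hsmooth.mono hut)

variable (g : ContMDiffRiemannianMetric I ∞ E (fun x : M ↦ TangentSpace I x))

lemma eq_of_forall_inner_eq {u v : TangentSpace I x}
    (h : ∀ w, g.inner x u w = g.inner x v w) : u = v := by
  by_contra huv
  have hpos := g.pos x (u - v) (sub_ne_zero.mpr huv)
  simp [h] at hpos

lemma mdiffAt_inner (hX : MDiffAt (T% X) x) (hY : MDiffAt (T% Y) x) :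
    MDiffAt (fun y ↦ g.inner y (X y) (Y y)) x := by
  have hg := (g.contMDiff.contMDiffAt (x := x)).mdifferentiableAt (by simp)
  have hinner := MDifferentiableAt.clm_bundle_apply₂ (F₁ := E) (F₂ := E) (F₃ := ℝ)
    (E₃ := Bundle.Trivial M ℝ) (b := fun x : M ↦ x) hg hX hY
  exact ((mdifferentiableAt_totalSpace ..).mp hinner).2

lemma dirDeriv_inner_comm (X Y Z : Π x : M, TangentSpace I x) (x : M) :
    dirDeriv X (fun y ↦ g.inner y (Y y) (Z y)) x
      = dirDeriv X (fun y ↦ g.inner y (Z y) (Y y)) x := by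
  simp only [g.symm]

lemma dirDeriv_inner_add_left (hY : MDiffAt (T% Y) x) (hY' : MDiffAt (T% Y') x)
    (hZ : MDiffAt (T% Z) x) :
    dirDeriv X (fun y ↦ g.inner y ((Y + Y') y) (Z y)) x
      = dirDeriv X (fun y ↦ g.inner y (Y y) (Z y)) x
        + dirDeriv X (fun y ↦ g.inner y (Y' y) (Z y)) x := by
  simp only [dirDeriv, Pi.add_apply, map_add, _root_.add_apply,
    mvfderiv_fun_add (mdiffAt_inner g hY hZ) (mdiffAt_inner g hY' hZ)]

lemma dirDeriv_inner_smul_left {φ : M → ℝ} (hφ : MDiffAt φ x) (hY : MDiffAt (T% Y) x)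
    (hZ : MDiffAt (T% Z) x) :
    dirDeriv X (fun y ↦ g.inner y ((φ • Y) y) (Z y)) x
      = φ x * dirDeriv X (fun y ↦ g.inner y (Y y) (Z y)) x
        + dirDeriv X φ x * g.inner x (Y x) (Z x) := by
  simp only [dirDeriv, Pi.smul_apply', map_smul, _root_.smul_apply, smul_eq_mul,
    mvfderiv_fun_mul hφ (mdiffAt_inner g hY hZ), _root_.add_apply]
  ring

/-- The Koszul expression, which is `2 g(∇_X Y, Z)` for the Levi-Civita connection `∇`. The
arguments of `g` are ordered so that `Y` stands on the left wherever it is differentiated. -/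
noncomputable def koszul (X Y Z : Π x : M, TangentSpace I x) (x : M) : ℝ :=
  dirDeriv X (fun y ↦ g.inner y (Y y) (Z y)) x + dirDeriv Y (fun y ↦ g.inner y (X y) (Z y)) x
    - dirDeriv Z (fun y ↦ g.inner y (Y y) (X y)) x
    + g.inner x (mlieBracket I X Y x) (Z x) - g.inner x (mlieBracket I Y Z x) (X x)
    - g.inner x (mlieBracket I X Z x) (Y x)

lemma koszul_sub_swap_left (X Y Z : Π x : M, TangentSpace I x) (x : M) :
    koszul g X Y Z x - koszul g Y X Z x = 2 * g.inner x (mlieBracket I X Y x) (Z x) := by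
  simp only [koszul, dirDeriv_inner_comm g Z X Y, mlieBracket_swap_apply (V := Y) (W := X),
    map_neg, _root_.neg_apply]
  ring

lemma koszul_add_swap_right (X Y Z : Π x : M, TangentSpace I x) (x : M) :
    koszul g X Y Z x + koszul g X Z Y x
      = 2 * dirDeriv X (fun y ↦ g.inner y (Y y) (Z y)) x := by
  simp only [koszul, dirDeriv_inner_comm g _ Z, dirDeriv_inner_comm g Z Y X,
    mlieBracket_swap_apply (V := Z) (W := Y), map_neg, _root_.neg_apply]
  ring

variable [FiniteDimensional ℝ E]

lemma koszul_add (hX : MDiffAt (T% X) x) (hY : MDiffAt (T% Y) x) (hY' : MDiffAt (T% Y') x)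
    (hZ : MDiffAt (T% Z) x) :
    koszul g X (Y + Y') Z x = koszul g X Y Z x + koszul g X Y' Z x := by
  simp only [koszul, dirDeriv_inner_add_left g hY hY' hZ, dirDeriv_inner_add_left g hY hY' hX,
    mlieBracket_add_left hY hY', mlieBracket_add_right hY hY']
  simp only [dirDeriv, Pi.add_apply, map_add, _root_.add_apply]
  ring

lemma koszul_smul {φ : M → ℝ} (hφ : MDiffAt φ x) (hX : MDiffAt (T% X) x)
    (hY : MDiffAt (T% Y) x) (hZ : MDiffAt (T% Z) x) :
    koszul g X (φ • Y) Z x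
      = φ x * koszul g X Y Z x + 2 * (dirDeriv X φ x * g.inner x (Y x) (Z x)) := by
  simp only [koszul, dirDeriv_inner_smul_left g hφ hY hZ, dirDeriv_inner_smul_left g hφ hY hX,
    mlieBracket_smul_left hφ hY, mlieBracket_smul_right hφ hY]
  simp only [dirDeriv, Pi.smul_apply', map_add, map_smul, _root_.add_apply, _root_.smul_apply,
    smul_eq_mul]
  ring

lemma koszul_tensorialAt_left (hY : MDiffAt (T% Y) x) (hZ : MDiffAt (T% Z) x) :
    TensorialAt I E (fun X ↦ koszul g X Y Z x) x := by
  have hswap (X : Π x : M, TangentSpace I x) :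
      koszul g X Y Z x = koszul g Y X Z x + 2 * g.inner x (mlieBracket I X Y x) (Z x) := by
    linarith [koszul_sub_swap_left g X Y Z x]
  simp only [hswap]
  refine ⟨fun {φ X} hφ hX ↦ ?_, fun {X X'} hX hX' ↦ ?_⟩
  · simp only [koszul_smul g hφ hY hX hZ, mlieBracket_smul_left hφ hX, dirDeriv, map_add,
      map_smul, _root_.add_apply, _root_.smul_apply, smul_eq_mul]
    ring
  · simp only [koszul_add g hY hX hX' hZ, mlieBracket_add_left hX hX', map_add, _root_.add_apply]
    ring

lemma koszul_tensorialAt_right (hX : MDiffAt (T% X) x) (hY : MDiffAt (T% Y) x) :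
    TensorialAt I E (fun Z ↦ koszul g X Y Z x) x := by
  have hswap (Z : Π x : M, TangentSpace I x) :
      koszul g X Y Z x
        = 2 * dirDeriv X (fun y ↦ g.inner y (Z y) (Y y)) x - koszul g X Z Y x := by
    linarith [koszul_add_swap_right g X Z Y x]
  simp only [hswap]
  refine ⟨fun {φ Z} hφ hZ ↦ ?_, fun {Z Z'} hZ hZ' ↦ ?_⟩
  · simp only [koszul_smul g hφ hX hZ hY, dirDeriv_inner_smul_left g hφ hZ hY, smul_eq_mul]
    ring
  · simp only [koszul_add g hX hZ hZ' hY, dirDeriv_inner_add_left g hZ hZ' hY]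
    ring

/-- The musical isomorphism `TₓM ≃ Tₓ*M` of a Riemannian metric. -/
noncomputable def flat (x : M) : TangentSpace I x ≃ₗ[ℝ] (TangentSpace I x →L[ℝ] ℝ) :=
  haveI : FiniteDimensional ℝ (TangentSpace I x) := inferInstanceAs (FiniteDimensional ℝ E)
  haveI : T2Space (TangentSpace I x) := inferInstanceAs (T2Space E)
  LinearEquiv.ofInjectiveOfFinrankEq (g.inner x).toLinearMap
    (fun _ _ h ↦ eq_of_forall_inner_eq g fun w ↦ congrArg (fun φ ↦ φ w) h)
    (Subspace.dual_finrank_eq.symm.trans LinearMap.toContinuousLinearMap.finrank_eq)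

lemma inner_flat_symm (φ : TangentSpace I x →L[ℝ] ℝ) (w : TangentSpace I x) :
    g.inner x ((flat g x).symm φ) w = φ w :=
  congrArg (fun ψ : TangentSpace I x →L[ℝ] ℝ ↦ ψ w) ((flat g x).apply_symm_apply φ)

open Classical in
/-- The derivative `∇Y` at `x` of the Levi-Civita connection, characterized by
`2 g(∇_X Y, Z) = koszul g X Y Z`, with junk value `0` if `Y` is not differentiable at `x`. -/
noncomputable def leviCivitaDeriv (Y : Π x : M, TangentSpace I x) (x : M) :
    TangentSpace I x →L[ℝ] TangentSpace I x :=
  haveI : FiniteDimensional ℝ (TangentSpace I x) := inferInstanceAs (FiniteDimensional ℝ E)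
  haveI : T2Space (TangentSpace I x) := inferInstanceAs (T2Space E)
  if hY : MDiffAt (T% Y) x then
    LinearMap.toContinuousLinearMap ((1 / 2 : ℝ) • (flat g x).symm.toLinearMap ∘ₗ
      (TensorialAt.mkHom₂ (I := I) (F := E) (F' := E) (fun X Z ↦ koszul g X Y Z x) x
        (fun _ hZ ↦ koszul_tensorialAt_left g hY hZ)
        (fun _ hX ↦ koszul_tensorialAt_right g hX hY)).toLinearMap)
  else 0

lemma two_mul_inner_leviCivitaDeriv (hX : MDiffAt (T% X) x) (hY : MDiffAt (T% Y) x)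
    (hZ : MDiffAt (T% Z) x) :
    2 * g.inner x (leviCivitaDeriv g Y x (X x)) (Z x) = koszul g X Y Z x := by
  rw [leviCivitaDeriv, dif_pos hY]
  simp only [LinearMap.coe_toContinuousLinearMap', LinearMap.comp_apply,
    LinearEquiv.coe_coe, map_smul, _root_.smul_apply, inner_flat_symm, smul_eq_mul,
    ContinuousLinearMap.coe_coe, TensorialAt.mkHom₂_apply _ _ hX hZ]
  ring

lemma leviCivitaDeriv_eq (hY : MDiffAt (T% Y) x)
    {A : TangentSpace I x →L[ℝ] TangentSpace I x}
    (hA : ∀ X Z : Π x : M, TangentSpace I x, MDiffAt (T% X) x → MDiffAt (T% Z) x →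
      koszul g X Y Z x = 2 * g.inner x (A (X x)) (Z x)) :
    leviCivitaDeriv g Y x = A := by
  ext v
  refine eq_of_forall_inner_eq g fun w ↦ ?_
  have hv := FiberBundle.mdifferentiableAt_extend I E v
  have hw := FiberBundle.mdifferentiableAt_extend I E w
  simpa using (two_mul_inner_leviCivitaDeriv g hv hY hw).trans (hA _ _ hv hw)

/-- The Levi-Civita connection of a smooth Riemannian metric. -/
noncomputable def leviCivita : CovariantDerivative I E (fun x : M ↦ TangentSpace I x) where
  toFun := leviCivitaDeriv g
  isCovariantDerivativeOnUniv :=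
    { add := fun {Y Y' x} hY hY' _ ↦ by
        refine leviCivitaDeriv_eq g (mdifferentiableAt_add_section hY hY') fun X Z hX hZ ↦ ?_
        simp only [koszul_add g hX hY hY' hZ, ← two_mul_inner_leviCivitaDeriv g hX hY hZ,
          ← two_mul_inner_leviCivitaDeriv g hX hY' hZ, map_add, _root_.add_apply]
        ring
      leibniz := fun {Y φ x} hY hφ _ ↦ by
        refine leviCivitaDeriv_eq g (hφ.smul_section hY) fun X Z hX hZ ↦ ?_
        simp only [koszul_smul g hφ hX hY hZ, ← two_mul_inner_leviCivitaDeriv g hX hY hZ,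
          dirDeriv, map_add, map_smul, _root_.add_apply, _root_.smul_apply, smul_eq_mul,
          ContinuousLinearMap.smulRight_apply]
        ring }

lemma two_mul_inner_leviCivita (hX : MDiffAt (T% X) x) (hY : MDiffAt (T% Y) x)
    (hZ : MDiffAt (T% Z) x) :
    2 * g.inner x (leviCivita g Y x (X x)) (Z x) = koszul g X Y Z x :=
  two_mul_inner_leviCivitaDeriv g hX hY hZ

theorem isLeviCivita_leviCivita : IsLeviCivita g (leviCivita g) := by
  constructor
  · rw [CovariantDerivative.torsion_eq_zero_iff]
    intro X Y x hX hY
    refine eq_of_forall_inner_eq g fun w ↦ ?_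
    have hw := FiberBundle.mdifferentiableAt_extend I E w
    have hswap := koszul_sub_swap_left g X Y (FiberBundle.extend E w) x
    rw [← two_mul_inner_leviCivita g hX hY hw, ← two_mul_inner_leviCivita g hY hX hw,
      FiberBundle.extend_apply_self] at hswap
    rw [map_sub, _root_.sub_apply]
    linarith
  · intro X Y Z hX hY hZ x
    have hswap := koszul_add_swap_right g X Y Z x
    rw [← two_mul_inner_leviCivita g (hX.mdiffAt x) (hY.mdiffAt x) (hZ.mdiffAt x),
      ← two_mul_inner_leviCivita g (hX.mdiffAt x) (hZ.mdiffAt x) (hY.mdiffAt x)] at hswap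
    rw [g.symm x (Y x)]
    linarith

end LeviCivita

section EndField

variable {E : Type*} [NormedAddCommGroup E] [NormedSpace ℝ E]
  {H : Type*} [TopologicalSpace H] {I : ModelWithCorners ℝ E H}
  {M : Type*} [TopologicalSpace M] [ChartedSpace H M] [IsManifold I ∞ M]

/-- The covariant derivative `(∇_X S) Y = ∇_X (S Y) - S (∇_X Y)` of an endomorphism field. -/
noncomputable def covEnd (cov : CovariantDerivative I E (fun x : M ↦ TangentSpace I x))
    (S : Π x : M, TangentSpace I x →L[ℝ] TangentSpace I x) (X Y : Π x : M, TangentSpace I x)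
    (x : M) : TangentSpace I x :=
  cov (app S Y) x (X x) - S x (cov Y x (X x))

/-- The covariant derivative `(∇_X b)(Y, Z) = g(Y, (∇_X S) Z)` of the bilinear form
`b(Y, Z) = g(Y, S Z)`, for a metric connection `∇`. -/
noncomputable def covForm (g : ContMDiffRiemannianMetric I ∞ E (fun x : M ↦ TangentSpace I x))
    (cov : CovariantDerivative I E (fun x : M ↦ TangentSpace I x))
    (S : Π x : M, TangentSpace I x →L[ℝ] TangentSpace I x) (X Y Z : Π x : M, TangentSpace I x)
    (x : M) : ℝ :=
  g.inner x (Y x) (covEnd cov S X Z x)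

variable {g : ContMDiffRiemannianMetric I ∞ E (fun x : M ↦ TangentSpace I x)}
  {cov : CovariantDerivative I E (fun x : M ↦ TangentSpace I x)}
  {S : Π x : M, TangentSpace I x →L[ℝ] TangentSpace I x} {X Y Z W ζ : Π x : M, TangentSpace I x}

lemma cov_app (x : M) :
    cov (app S Y) x (X x) = covEnd cov S X Y x + S x (cov Y x (X x)) :=
  (sub_add_cancel ..).symm

namespace IsLeviCivita

variable [FiniteDimensional ℝ E]

lemma mlieBracket_eq (h : IsLeviCivita g cov) (hX : SmoothVectorField X)
    (hY : SmoothVectorField Y) (x : M) :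
    mlieBracket I X Y x = cov Y x (X x) - cov X x (Y x) :=
  ((CovariantDerivative.torsion_eq_zero_iff cov).mp h.1 (hX.mdiffAt x) (hY.mdiffAt x)).symm

lemma dirDeriv_inner_app (h : IsLeviCivita g cov) (hX : SmoothVectorField X)
    (hY : SmoothVectorField Y) (hSZ : SmoothVectorField (app S Z)) (x : M) :
    dirDeriv X (fun y ↦ g.inner y (Y y) (S y (Z y))) x
      = g.inner x (cov Y x (X x)) (S x (Z x)) + covForm g cov S X Y Z x
        + g.inner x (Y x) (S x (cov Z x (X x))) := by
  have hmetric := h.2 X Y (app S Z) hX hY hSZ x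
  rw [cov_app, map_add, ← add_assoc] at hmetric
  exact hmetric

lemma dOneForm_eq (h : IsLeviCivita g cov) {α : Π x : M, TangentSpace I x →L[ℝ] ℝ}
    (hα : ∀ x v, α x v = g.inner x (ζ x) v) (hζ : SmoothVectorField ζ)
    (hX : SmoothVectorField X) (hY : SmoothVectorField Y) (x : M) :
    2 * dOneForm α X Y x
      = g.inner x (cov ζ x (X x)) (Y x) - g.inner x (cov ζ x (Y x)) (X x) := by
  simp only [dOneForm, hα, h.mlieBracket_eq hX hY, h.2 X ζ Y hX hζ hY, h.2 Y ζ X hY hζ hX,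
    map_sub]
  ring

lemma nijenhuis_eq (h : IsLeviCivita g cov) (hS : SmoothEndField S)
    (hX : SmoothVectorField X) (hY : SmoothVectorField Y) (x : M) :
    nijenhuis S X Y x = covEnd cov S (app S X) Y x - covEnd cov S (app S Y) X x
      - S x (covEnd cov S X Y x) + S x (covEnd cov S Y X x) := by
  have hSX := hS.app hX
  have hSY := hS.app hY
  simp only [nijenhuis, covEnd, h.mlieBracket_eq hX hY, h.mlieBracket_eq hSX hSY,
    h.mlieBracket_eq hSX hY, h.mlieBracket_eq hX hSY, map_sub]
  abel

lemma covForm_skew (h : IsLeviCivita g cov) (hS : SmoothEndField S)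
    (hskew : ∀ x u v, g.inner x u (S x v) = -g.inner x v (S x u))
    (hX : SmoothVectorField X) (hY : SmoothVectorField Y) (hZ : SmoothVectorField Z) (x : M) :
    covForm g cov S X Y Z x = -covForm g cov S X Z Y x := by
  have hderiv : dirDeriv X (fun y ↦ g.inner y (Y y) (S y (Z y))) x
      = -dirDeriv X (fun y ↦ g.inner y (Z y) (S y (Y y))) x := by
    simp only [dirDeriv, hskew _ (Y _) (Z _), mvfderiv_fun_neg, _root_.neg_apply]
  rw [h.dirDeriv_inner_app hX hY (hS.app hZ), h.dirDeriv_inner_app hX hZ (hS.app hY)] at hderiv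
  linarith [hskew x (Y x) (cov Z x (X x)), hskew x (Z x) (cov Y x (X x))]

lemma three_mul_dTwoForm_eq (h : IsLeviCivita g cov) (hS : SmoothEndField S)
    (hskew : ∀ x u v, g.inner x u (S x v) = -g.inner x v (S x u))
    (hX : SmoothVectorField X) (hY : SmoothVectorField Y) (hZ : SmoothVectorField Z) (x : M) :
    3 * dTwoForm (fun x u v ↦ g.inner x u (S x v)) X Y Z x
      = covForm g cov S X Y Z x + covForm g cov S Y Z X x + covForm g cov S Z X Y x := by
  simp only [dTwoForm, h.dirDeriv_inner_app hX hY (hS.app hZ),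
    h.dirDeriv_inner_app hY hZ (hS.app hX), h.dirDeriv_inner_app hZ hX (hS.app hY),
    h.mlieBracket_eq hX hY, h.mlieBracket_eq hZ hX, h.mlieBracket_eq hY hZ, map_sub,
    _root_.sub_apply]
  linarith [hskew x (X x) (cov Y x (Z x)), hskew x (Y x) (cov Z x (X x)),
    hskew x (Z x) (cov X x (Y x))]

lemma inner_nijenhuis (h : IsLeviCivita g cov) (hS : SmoothEndField S)
    (hskew : ∀ x u v, g.inner x u (S x v) = -g.inner x v (S x u))
    (hX : SmoothVectorField X) (hY : SmoothVectorField Y) (x : M) :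
    g.inner x (W x) (nijenhuis S X Y x)
      = covForm g cov S (app S X) W Y x - covForm g cov S (app S Y) W X x
        + covForm g cov S X (app S W) Y x - covForm g cov S Y (app S W) X x := by
  have hXY := hskew x (W x) (covEnd cov S X Y x)
  have hYX := hskew x (W x) (covEnd cov S Y X x)
  simp only [h.nijenhuis_eq hS hX hY, covForm, app, map_add, map_sub, g.symm x (S x (W x))]
  linarith

end IsLeviCivita

end EndField

namespace WeakMetricFStructure

variable {n s : ℕ} {M : Type*} [TopologicalSpace M]
  [ChartedSpace (EuclideanSpace ℝ (Fin (2 * n + s))) M] [IsManifold (𝓡 (2 * n + s)) ∞ M]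

section Pointwise

variable (S : WeakMetricFStructure n s M) (x : M) (u v : TangentSpace (𝓡 (2 * n + s)) x)

lemma f_ξ (i : Fin s) : S.f x (S.ξ i x) = 0 := by
  have hsq : S.f x (S.f x (S.ξ i x)) = 0 := by
    simp [S.f_sq, S.Q_ξ, S.η_ξ]
  have hcube := S.f_cube x (S.ξ i x)
  rwa [hsq, map_zero, zero_add, S.Q_ξ] at hcube

lemma app_f_ξ (i : Fin s) : app S.f (S.ξ i) = 0 :=
  funext fun x ↦ S.f_ξ x i

lemma η_eq_inner (i : Fin s) : S.η i x v = S.g.inner x (S.ξ i x) v := by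
  have hcompat := S.compatible x v (S.ξ i x)
  simp only [S.f_ξ, map_zero, S.Q_ξ, S.η_ξ, mul_ite, mul_one, mul_zero, Finset.sum_ite_eq',
    Finset.mem_univ, if_true] at hcompat
  rw [S.g.symm]
  linarith

lemma η_f (i : Fin s) : S.η i x (S.f x v) = 0 := by
  -- `f v` is the image under `f` of the component of `v` in `⋂ ker η^i`
  have hcontact := S.contact_invariant x (v - ∑ j, S.η j x v • S.ξ j x)
    (fun k ↦ by simp [S.η_ξ]) i
  simpa [S.f_ξ] using hcontact

lemma f_Q : S.f x (S.Q x v) = S.Q x (S.f x v) := by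
  have hcube := congrArg (S.f x) (S.f_sq x v)
  rw [S.f_sq x (S.f x v)] at hcube
  simpa [S.η_f, S.f_ξ] using hcube.symm

lemma inner_f_skew : S.g.inner x u (S.f x v) = -S.g.inner x v (S.f x u) := by
  obtain ⟨w, rfl⟩ := (S.nonsingular_Q x).2 v
  have hcompat := S.compatible x u (S.f x w)
  simp only [S.f_sq x w, S.η_f, map_add, map_neg, map_sum, map_smul,
    S.g.symm x (S.f x u) (S.ξ _ x), ← S.η_eq_inner, smul_zero, mul_zero, Finset.sum_const_zero,
    add_zero, sub_zero, ← S.f_Q] at hcompat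
  rw [S.g.symm x (S.Q x w), hcompat]

lemma f_Qtilde : S.f x (S.Qtilde x v) = S.Qtilde x (S.f x v) := by
  simp [Qtilde, S.f_Q]

lemma inner_Qtilde : S.g.inner x u (S.Qtilde x v)
    = S.g.inner x (S.f x u) (S.f x v) - S.g.inner x u v + ∑ i, S.η i x u * S.η i x v := by
  simp only [S.compatible, Qtilde, map_sub, _root_.sub_apply, ContinuousLinearMap.id_apply]
  ring

lemma inner_Qtilde_symm : S.g.inner x u (S.Qtilde x v) = S.g.inner x v (S.Qtilde x u) := by
  simp only [S.inner_Qtilde, S.g.symm x (S.f x u), S.g.symm x u, mul_comm (S.η _ x u)]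

lemma inner_Qtilde_f :
    S.g.inner x u (S.Qtilde x (S.f x v)) = -S.g.inner x (S.f x u) (S.Qtilde x v) := by
  rw [← S.f_Qtilde, S.inner_f_skew, S.g.symm]

lemma Qtilde_eq : S.Qtilde x v = ∑ i, S.η i x v • S.ξ i x - S.f x (S.f x v) - v := by
  simp only [Qtilde, S.f_sq, _root_.sub_apply, ContinuousLinearMap.id_apply]
  abel

lemma inner_xiBar : S.g.inner x (S.xiBar x) v = S.etaBar x v := by
  simp [xiBar, etaBar, S.η_eq_inner]

lemma f_xiBar : S.f x (S.xiBar x) = 0 := by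
  simp [xiBar, S.f_ξ]

lemma etaBar_f : S.etaBar x (S.f x v) = 0 := by
  simp [etaBar, S.η_f]

end Pointwise

lemma smoothVectorField_app_Qtilde (S : WeakMetricFStructure n s M)
    {X : Π x : M, TangentSpace (𝓡 (2 * n + s)) x} (hX : SmoothVectorField X) :
    SmoothVectorField (app S.Qtilde X) :=
  ContMDiff.sub_section (S.smooth_Q.app hX) hX

section KoszulIdentity

/-- The tensor `∑ (∇_X η^i)(Y) η^i(Z) = ∑ g(∇_X ξ_i, Y) η^i(Z)`, through which the covariant
derivatives of the contact forms enter. -/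
noncomputable def contactForm (S : WeakMetricFStructure n s M)
    (cov : CovariantDerivative (𝓡 (2 * n + s)) (EuclideanSpace ℝ (Fin (2 * n + s)))
      (fun x : M ↦ TangentSpace (𝓡 (2 * n + s)) x))
    (X Y Z : Π x : M, TangentSpace (𝓡 (2 * n + s)) x) (x : M) : ℝ :=
  ∑ i, S.g.inner x (cov (S.ξ i) x (X x)) (Y x) * S.η i x (Z x)

variable {S : WeakMetricFStructure n s M}
  {cov : CovariantDerivative (𝓡 (2 * n + s)) (EuclideanSpace ℝ (Fin (2 * n + s)))
    (fun x : M ↦ TangentSpace (𝓡 (2 * n + s)) x)}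
  {X Y Z : Π x : M, TangentSpace (𝓡 (2 * n + s)) x} {x : M}

lemma contactForm_app_f_right : S.contactForm cov X Y (app S.f Z) x = 0 := by
  simp [contactForm, app, S.η_f]

lemma mdiffAt_η (S : WeakMetricFStructure n s M) (hX : SmoothVectorField X) (i : Fin s) :
    MDifferentiableAt (𝓡 (2 * n + s)) 𝓘(ℝ) (fun y ↦ S.η i y (X y)) x := by
  simp only [S.η_eq_inner]
  exact mdiffAt_inner S.g ((S.smooth_ξ i).mdiffAt x) (hX.mdiffAt x)

lemma two_mul_sum_dη_mul_η (h : IsLeviCivita S.g cov) (hX : SmoothVectorField X)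
    (hY : SmoothVectorField Y) : 2 * ∑ i, dOneForm (S.η i) X Y x * S.η i x (Z x)
      = S.contactForm cov X Y Z x - S.contactForm cov Y X Z x := by
  simp only [contactForm, ← Finset.sum_sub_distrib, ← sub_mul, Finset.mul_sum, ← mul_assoc,
    h.dOneForm_eq (fun x v ↦ S.η_eq_inner x v _) (S.smooth_ξ _) hX hY]

lemma dirDeriv_η (h : IsLeviCivita S.g cov) (hX : SmoothVectorField X)
    (hY : SmoothVectorField Y) (i : Fin s) :
    dirDeriv X (fun y ↦ S.η i y (Y y)) x
      = S.g.inner x (cov (S.ξ i) x (X x)) (Y x) + S.η i x (cov Y x (X x)) := by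
  simp only [S.η_eq_inner, h.2 X (S.ξ i) Y hX (S.smooth_ξ i) hY]

lemma η_covEnd_f (h : IsLeviCivita S.g cov) (hX : SmoothVectorField X)
    (hZ : SmoothVectorField Z) (i : Fin s) :
    S.η i x (covEnd cov S.f X Z x) = -S.g.inner x (cov (S.ξ i) x (X x)) (S.f x (Z x)) := by
  have hcov : covEnd cov S.f X (S.ξ i) x = -S.f x (cov (S.ξ i) x (X x)) := by
    simp [covEnd, S.app_f_ξ]
  have hskew := h.covForm_skew S.smooth_f S.inner_f_skew hX (S.smooth_ξ i) hZ x
  rw [covForm, covForm, hcov, map_neg, neg_neg, S.inner_f_skew] at hskew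
  rw [S.η_eq_inner, hskew]

lemma covForm_f_app_Qtilde (h : IsLeviCivita S.g cov) (hX : SmoothVectorField X)
    (hZ : SmoothVectorField Z) :
    covForm S.g cov S.f X (app S.Qtilde Y) Z x
      = -covForm S.g cov S.f X (app S.f (app S.f Y)) Z x - covForm S.g cov S.f X Y Z x
        - S.contactForm cov X (app S.f Z) Y x := by
  have hsum : S.contactForm cov X (app S.f Z) Y x
      = -∑ i, S.η i x (Y x) * S.η i x (covEnd cov S.f X Z x) := by
    simp [contactForm, η_covEnd_f h hX hZ, app, mul_comm]
  simp only [covForm, app, S.Qtilde_eq, map_sub, map_sum, map_smul, _root_.sub_apply,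
    _root_.sum_apply, _root_.smul_apply, smul_eq_mul, ← S.η_eq_inner, hsum]
  ring

lemma dirDeriv_sum_η_mul_η (h : IsLeviCivita S.g cov) (hX : SmoothVectorField X)
    (hY : SmoothVectorField Y) (hZ : SmoothVectorField Z) :
    dirDeriv X (fun y ↦ ∑ i, S.η i y (Y y) * S.η i y (Z y)) x
      = S.contactForm cov X Y Z x + S.contactForm cov X Z Y x
        + ∑ i, (S.η i x (cov Y x (X x)) * S.η i x (Z x)
          + S.η i x (Y x) * S.η i x (cov Z x (X x))) := by
  have hprod (i : Fin s) : dirDeriv X (fun y ↦ S.η i y (Y y) * S.η i y (Z y)) x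
      = dirDeriv X (fun y ↦ S.η i y (Y y)) x * S.η i x (Z x)
        + dirDeriv X (fun y ↦ S.η i y (Z y)) x * S.η i x (Y x) := by
    simp only [dirDeriv, mvfderiv_fun_mul (S.mdiffAt_η hY i) (S.mdiffAt_η hZ i), _root_.add_apply,
      _root_.smul_apply, smul_eq_mul]
    ring
  rw [dirDeriv_sum (φ := fun i y ↦ S.η i y (Y y) * S.η i y (Z y)) _
    fun i ↦ (S.mdiffAt_η hY i).mul (S.mdiffAt_η hZ i)]
  simp only [hprod, dirDeriv_η h hX hY, dirDeriv_η h hX hZ, contactForm, ← Finset.sum_add_distrib]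
  exact Finset.sum_congr rfl fun i _ ↦ by ring

lemma covForm_Qtilde (h : IsLeviCivita S.g cov) (hX : SmoothVectorField X)
    (hY : SmoothVectorField Y) (hZ : SmoothVectorField Z) :
    covForm S.g cov S.Qtilde X Y Z x
      = covForm S.g cov S.f X (app S.f Y) Z x + covForm S.g cov S.f X (app S.f Z) Y x
        + S.contactForm cov X Y Z x + S.contactForm cov X Z Y x := by
  have hfY := S.smooth_f.app hY
  have hfZ := S.smooth_f.app hZ
  have hQZ := S.smoothVectorField_app_Qtilde hZ
  have hsum : (fun y ↦ ∑ i, S.η i y (Y y) * S.η i y (Z y))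
      = (fun y ↦ S.g.inner y (Y y) (app S.Qtilde Z y)) + (fun y ↦ S.g.inner y (Y y) (Z y))
        - fun y ↦ S.g.inner y (app S.f Y y) (app S.f Z y) := by
    ext y
    simp only [app, S.inner_Qtilde, Pi.add_apply, Pi.sub_apply]
    ring
  have hdiff {U V : Π x : M, TangentSpace (𝓡 (2 * n + s)) x} (hU : SmoothVectorField U)
      (hV : SmoothVectorField V) := mdiffAt_inner S.g (hU.mdiffAt x) (hV.mdiffAt x)
  have hderiv : dirDeriv X (fun y ↦ ∑ i, S.η i y (Y y) * S.η i y (Z y)) x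
      = dirDeriv X (fun y ↦ S.g.inner y (Y y) (S.Qtilde y (Z y))) x
        + dirDeriv X (fun y ↦ S.g.inner y (Y y) (Z y)) x
        - dirDeriv X (fun y ↦ S.g.inner y (app S.f Y y) (S.f y (Z y))) x := by
    rw [hsum, dirDeriv, mvfderiv_sub ((hdiff hY hQZ).add (hdiff hY hZ)) (hdiff hfY hfZ),
      mvfderiv_add (hdiff hY hQZ) (hdiff hY hZ)]
    rfl
  rw [h.dirDeriv_inner_app hX hY (S.smoothVectorField_app_Qtilde hZ),
    h.dirDeriv_inner_app hX hfY hfZ, h.2 X Y Z hX hY hZ, dirDeriv_sum_η_mul_η h hX hY hZ,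
    cov_app] at hderiv
  simp only [S.inner_Qtilde, Finset.sum_add_distrib] at hderiv
  have := S.g.symm x (S.f x (Z x)) (covEnd cov S.f X Y x)
  simp only [covForm, app, map_add, _root_.add_apply] at hderiv this ⊢
  linarith

lemma N5_eq (h : IsLeviCivita S.g cov) (hX : SmoothVectorField X) (hY : SmoothVectorField Y)
    (hZ : SmoothVectorField Z) :
    S.N5 X Y Z x
      = covForm S.g cov S.Qtilde X (app S.f Y) Z x - covForm S.g cov S.Qtilde (app S.f Y) X Z x
        + covForm S.g cov S.Qtilde (app S.f Z) X Y x + covForm S.g cov S.f X (app S.Qtilde Y) Z x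
        + covForm S.g cov S.f Y (app S.Qtilde X) Z x
        - covForm S.g cov S.f Z (app S.Qtilde X) Y x := by
  have hfY := S.smooth_f.app hY
  have hfZ := S.smooth_f.app hZ
  have hQY := S.smoothVectorField_app_Qtilde hY
  have hQZ := S.smoothVectorField_app_Qtilde hZ
  have hbracket : mlieBracket (𝓡 (2 * n + s)) Y (app S.f Z) x
        - mlieBracket (𝓡 (2 * n + s)) Z (app S.f Y) x
        - S.f x (mlieBracket (𝓡 (2 * n + s)) Y Z x)
      = covEnd cov S.f Y Z x - covEnd cov S.f Z Y x - cov Y x (app S.f Z x)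
        + cov Z x (app S.f Y x) := by
    simp only [h.mlieBracket_eq hY hfZ, h.mlieBracket_eq hZ hfY, h.mlieBracket_eq hY hZ, covEnd,
      map_sub]
    abel
  have hderiv : dirDeriv X (fun y ↦ S.g.inner y (S.f y (Y y)) (S.Qtilde y (Z y))) x = _ :=
    h.dirDeriv_inner_app hX hfY hQZ x
  rw [N5, hbracket, hderiv, h.dirDeriv_inner_app hfZ hX hQY,
    h.dirDeriv_inner_app hfY hX hQZ, h.mlieBracket_eq hX hfZ, h.mlieBracket_eq hX hfY,
    cov_app, cov_app]
  have hQ (u v) : S.g.inner x (S.Qtilde x u) v = S.g.inner x v (S.Qtilde x u) := S.g.symm x _ _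
  have hQf (W : Π x : M, TangentSpace (𝓡 (2 * n + s)) x) (u : TangentSpace (𝓡 (2 * n + s)) x) :
      S.g.inner x (S.f x (W x)) (S.Qtilde x u) = -S.g.inner x (S.f x u) (S.Qtilde x (W x)) := by
    rw [S.inner_Qtilde_symm, S.inner_Qtilde_f]
  simp only [covForm, app, map_add, map_sub, _root_.add_apply, _root_.sub_apply, hQ, hQf Y,
    S.inner_Qtilde_symm x (X x)]
  ring

lemma inner_f_N1 (v : TangentSpace (𝓡 (2 * n + s)) x) :
    S.g.inner x (S.f x v) (S.N1 X Y x) = S.g.inner x (S.f x v) (nijenhuis S.f X Y x) := by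
  simp [N1, S.g.symm x _ (S.ξ _ x), ← S.η_eq_inner, S.η_f]

theorem two_mul_inner_covEnd_f (h : IsLeviCivita S.g cov) (hX : SmoothVectorField X)
    (hY : SmoothVectorField Y) (hZ : SmoothVectorField Z) :
    2 * S.g.inner x (Z x) (covEnd cov S.f X Y x)
      = 3 * dTwoForm S.Phi X (app S.f Y) (app S.f Z) x - 3 * dTwoForm S.Phi X Y Z x
        + S.g.inner x (S.f x (X x)) (S.N1 Y Z x) + S.N5 X Y Z x
        + 2 * ∑ i, dOneForm (S.η i) (app S.f Y) Z x * S.η i x (X x)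
        - 2 * ∑ i, dOneForm (S.η i) (app S.f Z) Y x * S.η i x (X x)
        + 2 * ∑ i, dOneForm (S.η i) (app S.f Y) X x * S.η i x (Z x)
        - 2 * ∑ i, dOneForm (S.η i) (app S.f Z) X x * S.η i x (Y x) := by
  have hfY := S.smooth_f.app hY
  have hfZ := S.smooth_f.app hZ
  have hdΦ {U V W : Π x : M, TangentSpace (𝓡 (2 * n + s)) x} (hU : SmoothVectorField U)
      (hV : SmoothVectorField V) (hW : SmoothVectorField W) : 3 * dTwoForm S.Phi U V W x = _ :=
    h.three_mul_dTwoForm_eq S.smooth_f S.inner_f_skew hU hV hW x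
  have hN := h.inner_nijenhuis (W := app S.f X) S.smooth_f S.inner_f_skew hY hZ x
  have hskew {U V W : Π x : M, TangentSpace (𝓡 (2 * n + s)) x} (hU : SmoothVectorField U)
      (hV : SmoothVectorField V) (hW : SmoothVectorField W) :=
    h.covForm_skew S.smooth_f S.inner_f_skew hU hV hW x
  rw [hdΦ hX hfY hfZ, hdΦ hX hY hZ, inner_f_N1, ← app, hN, N5_eq h hX hY hZ,
    covForm_Qtilde h hX hfY hZ, covForm_Qtilde h hfY hX hZ, covForm_Qtilde h hfZ hX hY,
    covForm_f_app_Qtilde h hX hZ, covForm_f_app_Qtilde h hY hZ, covForm_f_app_Qtilde h hZ hY,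
    two_mul_sum_dη_mul_η h hfY hZ, two_mul_sum_dη_mul_η h hfZ hY, two_mul_sum_dη_mul_η h hfY hX,
    two_mul_sum_dη_mul_η h hfZ hX, contactForm_app_f_right, ← covForm]
  linarith [hskew hX hY hZ, hskew hY hX hZ, hskew hZ hX hY, hskew hX hfY hfZ, hskew hfZ hX hfY]

end KoszulIdentity

section Kenmotsu

section Conditions

variable (S : WeakMetricFStructure n s M)

/-- The Kenmotsu condition `(∇_X f) Y = β {g(fX,Y) ξ̄ - η̄(Y) fX}` on a connection `∇`. -/
def HasKenmotsuDerivative (β : M → ℝ)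
    (cov : CovariantDerivative (𝓡 (2 * n + s)) (EuclideanSpace ℝ (Fin (2 * n + s)))
      (fun x : M ↦ TangentSpace (𝓡 (2 * n + s)) x)) : Prop :=
  ∀ X Y : Π x : M, TangentSpace (𝓡 (2 * n + s)) x,
    SmoothVectorField X → SmoothVectorField Y → ∀ x,
      covEnd cov S.f X Y x = β x • (S.g.inner x (S.f x (X x)) (Y x) • S.xiBar x
        - S.etaBar x (Y x) • S.f x (X x))

/-- The contact forms are closed: `dη^i = 0`. -/
def IsEtaClosed : Prop :=
  ∀ i, ∀ X Y : Π x : M, TangentSpace (𝓡 (2 * n + s)) x,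
    SmoothVectorField X → SmoothVectorField Y → ∀ x, dOneForm (S.η i) X Y x = 0

/-- The Kenmotsu condition `dΦ = 2β η̄ ∧ Φ` on the fundamental form. -/
def HasKenmotsuDPhi (β : M → ℝ) : Prop :=
  ∀ X Y Z : Π x : M, TangentSpace (𝓡 (2 * n + s)) x,
    SmoothVectorField X → SmoothVectorField Y → SmoothVectorField Z → ∀ x,
      dTwoForm S.Phi X Y Z x = 2 * β x * wedgeOneTwo (S.etaBar x) (S.Phi x) (X x) (Y x) (Z x)

/-- The Kenmotsu condition `N⁽⁵⁾(X,Y,Z) = 2β η̄(X) g(fY,Q̃Z)`. -/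
def HasKenmotsuN5 (β : M → ℝ) : Prop :=
  ∀ X Y Z : Π x : M, TangentSpace (𝓡 (2 * n + s)) x,
    SmoothVectorField X → SmoothVectorField Y → SmoothVectorField Z → ∀ x,
      S.N5 X Y Z x
        = 2 * β x * S.etaBar x (X x) * S.g.inner x (S.f x (Y x)) (S.Qtilde x (Z x))

end Conditions

variable {S : WeakMetricFStructure n s M}
  {cov : CovariantDerivative (𝓡 (2 * n + s)) (EuclideanSpace ℝ (Fin (2 * n + s)))
    (fun x : M ↦ TangentSpace (𝓡 (2 * n + s)) x)}
  {X Y Z : Π x : M, TangentSpace (𝓡 (2 * n + s)) x} {β : M → ℝ} {x : M}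

lemma dOneForm_η_eq_zero (hN1 : S.N1 X Y x = 0) (hnij : nijenhuis S.f X Y x = 0) (i : Fin s) :
    dOneForm (S.η i) X Y x = 0 := by
  rw [N1, hnij, zero_add] at hN1
  simpa [S.η_ξ] using congrArg (S.η i x) hN1

namespace HasKenmotsuDerivative

lemma inner_covEnd (hK : S.HasKenmotsuDerivative β cov) (hX : SmoothVectorField X)
    (hY : SmoothVectorField Y) (v : TangentSpace (𝓡 (2 * n + s)) x) :
    S.g.inner x v (covEnd cov S.f X Y x)
      = β x * (S.g.inner x (S.f x (X x)) (Y x) * S.etaBar x v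
        - S.etaBar x (Y x) * S.g.inner x (S.f x (X x)) v) := by
  simp [hK X Y hX hY x, S.g.symm x v, S.inner_xiBar]

lemma nijenhuis_eq_zero (hK : S.HasKenmotsuDerivative β cov) (h : IsLeviCivita S.g cov)
    (hX : SmoothVectorField X) (hY : SmoothVectorField Y) : nijenhuis S.f X Y x = 0 := by
  have hfX := S.smooth_f.app hX
  have hfY := S.smooth_f.app hY
  have hsymm : S.g.inner x (S.f x (S.f x (X x))) (Y x)
      = S.g.inner x (S.f x (S.f x (Y x))) (X x) := by
    rw [S.g.symm, S.inner_f_skew, S.g.symm x _ (X x), S.inner_f_skew x (X x),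
      S.g.symm x (S.f x (X x))]
  rw [h.nijenhuis_eq S.smooth_f hX hY, hK _ _ hfX hY, hK _ _ hX hY, hK _ _ hfY hX, hK _ _ hY hX]
  simp only [app, map_smul, map_sub, S.f_xiBar, smul_zero, zero_sub, hsymm]
  module

lemma isEtaClosed (hK : S.HasKenmotsuDerivative β cov) (h : IsLeviCivita S.g cov)
    (hN1 : S.IsNormal) : S.IsEtaClosed :=
  fun i X Y hX hY x ↦ dOneForm_η_eq_zero (hN1 X Y hX hY x) (hK.nijenhuis_eq_zero h hX hY) i

lemma hasKenmotsuDPhi (hK : S.HasKenmotsuDerivative β cov) (h : IsLeviCivita S.g cov) :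
    S.HasKenmotsuDPhi β := by
  intro X Y Z hX hY hZ x
  have hdΦ : 3 * dTwoForm S.Phi X Y Z x = _ :=
    h.three_mul_dTwoForm_eq S.smooth_f S.inner_f_skew hX hY hZ x
  rw [covForm, covForm, covForm, hK.inner_covEnd hX hZ, hK.inner_covEnd hY hX,
    hK.inner_covEnd hZ hY] at hdΦ
  have hsymm (u v) : S.g.inner x (S.f x u) v = S.Phi x v u := S.g.symm x _ _
  have hskew (u v) : S.Phi x u v = -S.Phi x v u := S.inner_f_skew x u v
  rw [hsymm, hsymm, hsymm, hsymm, hsymm, hsymm, hskew (X x) (Z x), hskew (Y x) (X x),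
    hskew (Z x) (Y x)] at hdΦ
  rw [wedgeOneTwo]
  linear_combination hdΦ / 3

end HasKenmotsuDerivative

lemma HasKenmotsuDPhi.three_mul_dPhi_app_sub (hΦ : S.HasKenmotsuDPhi β)
    (hX : SmoothVectorField X) (hY : SmoothVectorField Y) (hZ : SmoothVectorField Z) :
    3 * dTwoForm S.Phi X (app S.f Y) (app S.f Z) x - 3 * dTwoForm S.Phi X Y Z x
      = 2 * β x * (S.g.inner x (S.f x (X x)) (Y x) * S.etaBar x (Z x)
          - S.etaBar x (Y x) * S.g.inner x (S.f x (X x)) (Z x))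
        - 2 * β x * S.etaBar x (X x) * S.g.inner x (S.f x (Y x)) (S.Qtilde x (Z x)) := by
  have hΦf : S.Phi x (S.f x (Y x)) (S.f x (Z x))
      = S.Phi x (Y x) (Z x) - S.g.inner x (S.f x (Y x)) (S.Qtilde x (Z x)) := by
    have hQ := S.inner_Qtilde_f x (Y x) (Z x)
    simp only [S.inner_Qtilde, S.η_f, mul_zero, Finset.sum_const_zero] at hQ ⊢
    simp only [Phi]
    linarith
  have hXY : S.Phi x (X x) (Y x) = -S.g.inner x (S.f x (X x)) (Y x) := by
    rw [Phi, S.inner_f_skew, S.g.symm]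
  have hZX : S.Phi x (Z x) (X x) = S.g.inner x (S.f x (X x)) (Z x) := S.g.symm x _ _
  rw [hΦ X _ _ hX (S.smooth_f.app hY) (S.smooth_f.app hZ), hΦ X Y Z hX hY hZ]
  simp only [wedgeOneTwo, app, S.etaBar_f, hΦf, hXY, hZX]
  ring

lemma two_mul_inner_covEnd_f_sub (h : IsLeviCivita S.g cov) (hN1 : S.IsNormal)
    (hη : S.IsEtaClosed) (hΦ : S.HasKenmotsuDPhi β) (hX : SmoothVectorField X)
    (hY : SmoothVectorField Y) (hZ : SmoothVectorField Z) :
    2 * (S.g.inner x (Z x) (covEnd cov S.f X Y x)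
        - β x * (S.g.inner x (S.f x (X x)) (Y x) * S.etaBar x (Z x)
          - S.etaBar x (Y x) * S.g.inner x (S.f x (X x)) (Z x)))
      = S.N5 X Y Z x
        - 2 * β x * S.etaBar x (X x) * S.g.inner x (S.f x (Y x)) (S.Qtilde x (Z x)) := by
  have hfY := S.smooth_f.app hY
  have hfZ := S.smooth_f.app hZ
  have hkoszul := two_mul_inner_covEnd_f (x := x) h hX hY hZ
  simp only [hN1 Y Z hY hZ, hη _ _ _ hfY hZ, hη _ _ _ hfZ hY, hη _ _ _ hfY hX, hη _ _ _ hfZ hX,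
    hΦ.three_mul_dPhi_app_sub hX hY hZ, map_zero, zero_mul, Finset.sum_const_zero, mul_zero]
    at hkoszul
  linarith

lemma HasKenmotsuDerivative.hasKenmotsuN5 (hK : S.HasKenmotsuDerivative β cov)
    (h : IsLeviCivita S.g cov) (hN1 : S.IsNormal) : S.HasKenmotsuN5 β := by
  intro X Y Z hX hY hZ x
  have hN5 := two_mul_inner_covEnd_f_sub (x := x) h hN1 (hK.isEtaClosed h hN1)
    (hK.hasKenmotsuDPhi h) hX hY hZ
  rw [hK.inner_covEnd hX hY, sub_self, mul_zero] at hN5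
  exact sub_eq_zero.mp hN5.symm

lemma HasKenmotsuN5.hasKenmotsuDerivative [T2Space M] (hN5 : S.HasKenmotsuN5 β)
    (h : IsLeviCivita S.g cov) (hN1 : S.IsNormal) (hη : S.IsEtaClosed)
    (hΦ : S.HasKenmotsuDPhi β) : S.HasKenmotsuDerivative β cov := by
  intro X Y hX hY x
  refine eq_of_forall_inner_eq S.g fun w ↦ ?_
  obtain ⟨Z, hZ, rfl⟩ := exists_smoothVectorField_apply_eq x w
  have hcov := two_mul_inner_covEnd_f_sub (x := x) h hN1 hη hΦ hX hY hZ
  rw [hN5 X Y Z hX hY hZ, sub_self, S.g.symm] at hcov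
  simp only [map_smul, map_sub, _root_.smul_apply, _root_.sub_apply, smul_eq_mul, S.inner_xiBar]
  linarith

end Kenmotsu

end WeakMetricFStructure

end WeakKenmotsu

theorem theorem2p1_general {n s : ℕ} {M : Type*} [TopologicalSpace M] [T2Space M]
    [ChartedSpace (EuclideanSpace ℝ (Fin (2 * n + s))) M] [IsManifold (𝓡 (2 * n + s)) ∞ M]
    (S : WeakMetricFStructure n s M) (β : M → ℝ) :
    (S.IsNormal ∧ ∃ cov, IsLeviCivita S.g cov ∧ S.HasKenmotsuDerivative β cov)
      ↔ S.IsNormal ∧ S.IsEtaClosed ∧ S.HasKenmotsuDPhi β ∧ S.HasKenmotsuN5 β := by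
  constructor
  · rintro ⟨hN1, cov, h, hK⟩
    exact ⟨hN1, hK.isEtaClosed h hN1, hK.hasKenmotsuDPhi h, hK.hasKenmotsuN5 h hN1⟩
  · rintro ⟨hN1, hη, hΦ, hN5⟩
    have h := isLeviCivita_leviCivita S.g
    exact ⟨hN1, leviCivita S.g, h, hN5.hasKenmotsuDerivative h hN1 hη hΦ⟩

theorem theorem2p1 {n s : ℕ} (hn : 0 < n) (hs : 1 < s)
    {M : Type*} [TopologicalSpace M] [T2Space M] [SecondCountableTopology M]
    [ChartedSpace (EuclideanSpace ℝ (Fin (2 * n + s))) M] [IsManifold (𝓡 (2 * n + s)) ∞ M]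
    (S : WeakMetricFStructure n s M)
    (β : M → ℝ) (hβ : ContMDiff (𝓡 (2 * n + s)) 𝓘(ℝ) ∞ β) (hβ0 : β ≠ 0) :
    S.IsWeakBetaKenmotsu β ↔
      (∀ X Y : Π x : M, TangentSpace (𝓡 (2 * n + s)) x,
        SmoothVectorField X → SmoothVectorField Y → ∀ x, S.N1 X Y x = 0) ∧
      (∀ i, ∀ X Y : Π x : M, TangentSpace (𝓡 (2 * n + s)) x,
        SmoothVectorField X → SmoothVectorField Y → ∀ x, dOneForm (S.η i) X Y x = 0) ∧
      (∀ X Y Z : Π x : M, TangentSpace (𝓡 (2 * n + s)) x,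
        SmoothVectorField X → SmoothVectorField Y → SmoothVectorField Z → ∀ x,
          dTwoForm S.Phi X Y Z x
            = 2 * β x * wedgeOneTwo (S.etaBar x) (S.Phi x) (X x) (Y x) (Z x)) ∧
      (∀ X Y Z : Π x : M, TangentSpace (𝓡 (2 * n + s)) x,
        SmoothVectorField X → SmoothVectorField Y → SmoothVectorField Z → ∀ x,
          S.N5 X Y Z x
            = 2 * β x * S.etaBar x (X x)
                * S.g.inner x (S.f x (Y x)) (S.Qtilde x (Z x))) :=
  (and_iff_right hβ).trans <| (and_iff_right hβ0).trans (theorem2p1_general S β)
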